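/- Let $S$ be a semigroup with zero $0$. A $0$-module over $S$ is an abelian group $A$ with a multiplication $(S\setminus 0)\times A\to A$ such that $s(a+b)=sa+sb$ for all $s\in S\setminus 0$ and $a,b\in A$, and $s(ta)=(st)a$ whenever $s,t\in S\setminus 0$ and $st\neq 0$. **Gown.** Let $\overline S$ be the set of finite sequences $(x_1,\dots,x_m)$, $m\ge 1$, with $x_i\in S\setminus 0$ and $x_ix_{i+1}=0$ for $1\le i<m$. Let $\overline\rho$ be the least equivalence relation on $\overline S$ that contains the following pairs (all the sequences being in $\overline S$; $p,q$ are possibly empty blocks and $u,v\in S$): $$(p,\,au,\,b,\,q)\ \overline\rho\ (p,\,a,\,ub,\,q),\qquad (p,\,a,\,uv,\,b,\,q)\ \overline\rho\ (p,\,au,\,vb,\,q).$$ The gown of $S$ is the semigroup $\tilde S=\overline S/\overline\rho$ with the multiplication of classes $$[x_1,\dots,x_m][y_1,\dots,y_n]=\begin{cases}[x_1,\dots,x_my_1,\dots,y_n], & x_my_1\ne 0,\\ [x_1,\dots,x_m,y_1,\dots,y_n], & x_my_1=0.\end{cases}$$ Every $0$-module $A$ over $S$ is a module over $\tilde S$ via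 $[x_1,\dots,x_m]a=x_1(\cdots(x_ma)\cdots)$. **Cohomology.** For a semigroup $T$ and a $T$-module $A$, let $C^n(T,A)$ be the group of all maps $T^n\to A$, and let $$\partial^nf(x_1,\dots,x_{n+1})=x_1f(x_2,\dots,x_{n+1})+\sum_{i=1}^n(-1)^if(x_1,\dots,x_ix_{i+1},\dots,x_{n+1})+(-1)^{n+1}f(x_1,\dots,x_n).$$ The Eilenberg–MacLane cohomology is $H^n(T,A)=\operatorname{Ker}\partial^n/\operatorname{Im}\partial^{n-1}$ (with $\operatorname{Im}\partial^{-1}=0$). For a $0$-module $A$ over $S$, let $C_0^n(S,A)$ be the group of all maps to $A$ from the set of $n$-tuples $(x_1,\dots,x_n)$ of elements of $S$ with $x_1\cdots x_n\neq 0$ (for $n=0$ the empty tuple is admitted, so $C_0^0(S,A)=A$). The same formula defines $\partial^n:C_0^n(S,A)\to C_0^{n+1}(S,A)$, and the $0$-cohomology is $H_0^n(S,A)=\operatorname{Ker}\partial^n/\operatorname{Im}\partial^{n-1}$. **Comparison map.** The homomorphisms $\eta^n:C^n(\tilde S,A)\to C_0^n(S,A)$, $(\eta^nf)(x_1,\dots,x_n)=f([x_1],\dots,[x_n])$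 for $x_1\cdots x_n\ne 0$, commute with the coboundary operators and induce group homomorphisms $\varepsilon^n:H^n(\tilde S,A)\to H_0^n(S,A)$. **Theorem 5.** If $S$ is categorical at zero, that is, if for all $x,y,z\in S$ the equality $xyz=0$ implies $xy=0$ or $yz=0$, then $\varepsilon^n$ is an isomorphism for every $0$-module $A$ over $S$ and every $n\ge 0$. -/

import Mathlib

universe u v

namespace ZeroCohomology

noncomputable section

open Classical

/-! ### Eilenberg–MacLane cohomology of a semigroup -/

/-- A (left) module over a semigroup `T`: an abelian group on which `T` acts by additive maps,
compatibly with the multiplication of `T`. -/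
class SemigroupModule (T : Type u) (A : Type v) [Semigroup T] [AddCommGroup A] extends
    SMul T A where
  smul_add : ∀ (t : T) (a b : A), t • (a + b) = t • a + t • b
  mul_smul : ∀ (s t : T) (a : A), (s * t) • a = s • t • a

section EM

variable (T : Type u) (A : Type v) [Semigroup T] [AddCommGroup A] [SemigroupModule T A]

/-- The group `C^n(T, A)` of all `n`-place mappings from `T` to `A`. -/
abbrev Cochain (n : ℕ) : Type (max u v) := (Fin n → T) → A

/-- The coboundary operator `∂^n : C^n(T, A) → C^{n+1}(T, A)`. The tuple `x` is indexed from `0`.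
For `j < n` the tuple `Fin.contractNth j (· * ·) x` is `(x_0, …, x_j x_{j+1}, …, x_n)`; for `j = n`
it is `(x_0, …, x_{n-1})`, so the last summand is `(-1)^{n+1} f (x_0, …, x_{n-1})`. -/
def coboundary (n : ℕ) : Cochain T A n →+ Cochain T A (n + 1) where
  toFun f := fun x =>
    x 0 • f (fun i => x i.succ) +
      ∑ j : Fin (n + 1), (-1 : ℤ) ^ ((j : ℕ) + 1) • f (Fin.contractNth j (· * ·) x)
  map_zero' := by
    funext x
    have h : x 0 • (0 : A) = 0 := by
      have := SemigroupModule.smul_add (x 0) (0 : A) 0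
      simpa using this
    simp [h]
  map_add' f g := by
    funext x
    simp only [Pi.add_apply, SemigroupModule.smul_add, smul_add, Finset.sum_add_distrib]
    abel

/-- `Z^n(T, A)`, the kernel of `∂^n`. -/
def cocycles (n : ℕ) : AddSubgroup (Cochain T A n) := (coboundary T A n).ker

/-- `B^n(T, A)`, the image of `∂^{n-1}`; it is trivial for `n = 0`. -/
def coboundaries : (n : ℕ) → AddSubgroup (Cochain T A n)
  | 0 => ⊥
  | n + 1 => (coboundary T A n).range

/-- The Eilenberg–MacLane cohomology group `H^n(T, A) = Z^n(T, A) / B^n(T, A)`, with `B^n(T, A)`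
regarded as a subgroup of `Z^n(T, A)` (it is contained in it as `∂ ∘ ∂ = 0`). -/
abbrev EMCohomology (n : ℕ) : Type (max u v) :=
  cocycles T A n ⧸ (coboundaries T A n).addSubgroupOf (cocycles T A n)

end EM

/-! ### 0-modules and 0-cohomology of a semigroup with zero -/

/-- The set `S \ 0`. -/
abbrev NZ (S : Type u) [Zero S] : Type u := {s : S // s ≠ 0}

/-- A 0-module over a semigroup `S` with zero: an abelian group `A` with a multiplication
`(S \ 0) × A → A` such that `s (a + b) = s a + s b`, and `s (t a) = (s t) a` whenever `s t ≠ 0`. -/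
class ZeroModule (S : Type u) (A : Type v) [SemigroupWithZero S] [AddCommGroup A] where
  act : NZ S → A → A
  act_add : ∀ (s : NZ S) (a b : A), act s (a + b) = act s a + act s b
  act_act : ∀ (s t : NZ S) (h : s.1 * t.1 ≠ 0) (a : A),
    act s (act t a) = act ⟨s.1 * t.1, h⟩ a

/-- `S` is categorical at zero if `x y z = 0` implies `x y = 0` or `y z = 0`. -/
def CategoricalAtZero (S : Type u) [SemigroupWithZero S] : Prop :=
  ∀ x y z : S, x * y * z = 0 → x * y = 0 ∨ y * z = 0

section Tuples

variable {S : Type u} [SemigroupWithZero S]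

/-- The product `x_1 ⋯ x_n` of a tuple, taken in `S` with an identity adjoined, so that the product
of the empty tuple is `1`. -/
def tupleProd {n : ℕ} (x : Fin n → S) : WithOne S := (List.ofFn fun i => (x i : WithOne S)).prod

/-- `x_1 ⋯ x_n ≠ 0`. The empty tuple satisfies this. -/
def NonzeroProd {n : ℕ} (x : Fin n → S) : Prop := tupleProd x ≠ ((0 : S) : WithOne S)

theorem coe_zero_mul (w : WithOne S) : ((0 : S) : WithOne S) * w = ((0 : S) : WithOne S) := by
  cases w with
  | one => simp
  | coe a => rw [← WithOne.coe_mul, zero_mul]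

theorem mul_coe_zero (w : WithOne S) : w * ((0 : S) : WithOne S) = ((0 : S) : WithOne S) := by
  cases w with
  | one => simp
  | coe a => rw [← WithOne.coe_mul, mul_zero]

theorem tupleProd_succ {n : ℕ} (x : Fin (n + 1) → S) :
    tupleProd x = (x 0 : WithOne S) * tupleProd fun i => x i.succ := by
  simp [tupleProd, List.ofFn_succ]

theorem tupleProd_eq_partialProd {n : ℕ} (x : Fin n → S) :
    tupleProd x = Fin.partialProd (fun i => (x i : WithOne S)) (Fin.last n) := by
  unfold tupleProd Fin.partialProd
  rw [List.take_of_length_le (by simp)]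

theorem NonzeroProd.head {n : ℕ} {x : Fin (n + 1) → S} (h : NonzeroProd x) : x 0 ≠ 0 := by
  intro h0
  apply h
  rw [tupleProd_succ, h0, coe_zero_mul]

theorem NonzeroProd.tail {n : ℕ} {x : Fin (n + 1) → S} (h : NonzeroProd x) :
    NonzeroProd fun i => x i.succ := by
  intro h0
  apply h
  rw [tupleProd_succ, h0, mul_coe_zero]

theorem NonzeroProd.contract {n : ℕ} {x : Fin (n + 1) → S} (h : NonzeroProd x)
    (j : Fin (n + 1)) : NonzeroProd (Fin.contractNth j (· * ·) x) := by
  have key : tupleProd (Fin.contractNth j (· * ·) x) =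
      Fin.partialProd (fun i => (x i : WithOne S)) (j.succ.succAbove (Fin.last n)) := by
    rw [tupleProd_eq_partialProd]
    have := congrFun (Fin.partialProd_contractNth (fun i => (x i : WithOne S)) j) (Fin.last n)
    rw [Function.comp_apply] at this
    rw [← this]
    congr 1
    funext k
    unfold Fin.contractNth
    split_ifs <;> simp
  intro h0
  rw [key] at h0
  apply h
  rw [tupleProd_eq_partialProd]
  induction j using Fin.lastCases with
  | last =>
    rw [Fin.succ_last, Fin.succAbove_last] at h0
    rw [← Fin.succ_last, Fin.partialProd_succ, h0, coe_zero_mul]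
  | cast j =>
    rwa [Fin.succAbove_of_le_castSucc _ _ (by
      rw [Fin.le_def]; simp), Fin.succ_last] at h0

theorem NonzeroProd.ne_zero : ∀ {n : ℕ} {x : Fin n → S}, NonzeroProd x → ∀ i, x i ≠ 0
  | 0, _, _, i => i.elim0
  | _ + 1, _, h, i => by
    induction i using Fin.cases with
    | zero => exact h.head
    | succ i => exact NonzeroProd.ne_zero h.tail i

end Tuples

section Zero

variable (S : Type u) (A : Type v) [SemigroupWithZero S] [AddCommGroup A] [ZeroModule S A]

/-- The group `C_0^n(S, A)` of partial `n`-place mappings from `S` to `A`, defined on all `n`-tuples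
with nonzero product; in particular `C_0^0(S, A) = A`. -/
abbrev ZeroCochain (n : ℕ) : Type (max u v) := {x : Fin n → S // NonzeroProd x} → A

/-- The coboundary operator `∂^n : C_0^n(S, A) → C_0^{n+1}(S, A)`, given by the same formula as
`coboundary`. -/
def zeroCoboundary (n : ℕ) : ZeroCochain S A n →+ ZeroCochain S A (n + 1) where
  toFun f := fun x =>
    ZeroModule.act (⟨x.1 0, x.2.head⟩ : NZ S) (f ⟨fun i => x.1 i.succ, x.2.tail⟩) +
      ∑ j : Fin (n + 1), (-1 : ℤ) ^ ((j : ℕ) + 1) •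
        f ⟨Fin.contractNth j (· * ·) x.1, x.2.contract j⟩
  map_zero' := by
    funext x
    have h : ZeroModule.act (⟨x.1 0, x.2.head⟩ : NZ S) (0 : A) = 0 := by
      have := ZeroModule.act_add (⟨x.1 0, x.2.head⟩ : NZ S) (0 : A) 0
      simpa using this
    simp [h]
  map_add' f g := by
    funext x
    simp only [Pi.add_apply, ZeroModule.act_add, smul_add, Finset.sum_add_distrib]
    abel

/-- `Z_0^n(S, A)`, the kernel of `∂^n`. -/
def zeroCocycles (n : ℕ) : AddSubgroup (ZeroCochain S A n) := (zeroCoboundary S A n).ker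

/-- `B_0^n(S, A)`, the image of `∂^{n-1}`; it is trivial for `n = 0`. -/
def zeroCoboundaries : (n : ℕ) → AddSubgroup (ZeroCochain S A n)
  | 0 => ⊥
  | n + 1 => (zeroCoboundary S A n).range

/-- The 0-cohomology group `H_0^n(S, A) = Z_0^n(S, A) / B_0^n(S, A)`, with `B_0^n(S, A)` regarded
as a subgroup of `Z_0^n(S, A)` (it is contained in it as `∂ ∘ ∂ = 0`). -/
abbrev ZeroCohomologyGroup (n : ℕ) : Type (max u v) :=
  zeroCocycles S A n ⧸ (zeroCoboundaries S A n).addSubgroupOf (zeroCocycles S A n)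

end Zero

/-! ### The gown of a semigroup with zero -/

section Gown

/-- The set of nonempty finite sequences of nonzero elements with `x_i x_{i+1} = 0`. -/
def Seq (S : Type u) [SemigroupWithZero S] : Type u :=
  {l : List (NZ S) // l ≠ [] ∧ l.IsChain fun x y => x.1 * y.1 = 0}

/-- The relation `ρ`, on underlying lists. -/
inductive Rho {S : Type u} [SemigroupWithZero S] : List (NZ S) → List (NZ S) → Prop
  | slide (p q : List (NZ S)) (x₁ x₂ y₁ y₂ : NZ S) (w : S)
      (h₁ : x₁.1 = y₁.1 * w) (h₂ : y₂.1 = w * x₂.1) :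
      Rho (p ++ x₁ :: x₂ :: q) (p ++ y₁ :: y₂ :: q)
  | split (p q : List (NZ S)) (x₀ x₁ x₂ y₀ y₁ : NZ S) (w z : S)
      (h : x₁.1 = w * z) (h₀ : y₀.1 = x₀.1 * w) (h₁ : y₁.1 = z * x₂.1) :
      Rho (p ++ x₀ :: x₁ :: x₂ :: q) (p ++ y₀ :: y₁ :: q)

/-- The underlying set of the gown: the quotient of the set of sequences by the least equivalence
relation containing `ρ`. -/
def Gown (S : Type u) [SemigroupWithZero S] : Type u :=
  Quot fun l m : Seq S => Rho l.1 m.1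

variable {S : Type u} [SemigroupWithZero S]

/-- `(x_1, …, x_m) (y_1, …, y_n)` is `(x_1, …, x_m y_1, …, y_n)` if `x_m y_1 ≠ 0`, and
`(x_1, …, x_m, y_1, …, y_n)` if `x_m y_1 = 0`. -/
def glue : List (NZ S) → List (NZ S) → List (NZ S)
  | [], m => m
  | [x], [] => [x]
  | [x], y :: m => if h : x.1 * y.1 = 0 then x :: y :: m else ⟨x.1 * y.1, h⟩ :: m
  | x :: x' :: l, m => x :: glue (x' :: l) m

theorem glue_concat_cons (p : List (NZ S)) (x y : NZ S) (q : List (NZ S)) :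
    glue (p ++ [x]) (y :: q) =
      p ++ if h : x.1 * y.1 = 0 then x :: y :: q else ⟨x.1 * y.1, h⟩ :: q := by
  induction p with
  | nil => simp [glue]
  | cons a p ih =>
    cases p with
    | nil => simp [glue]
    | cons b p => simpa [glue] using ih

theorem glue_of_eq_zero {p : List (NZ S)} {x y : NZ S} {q : List (NZ S)} (h : x.1 * y.1 = 0) :
    glue (p ++ [x]) (y :: q) = p ++ x :: y :: q := by
  rw [glue_concat_cons, dif_pos h]

theorem glue_of_ne_zero {p : List (NZ S)} {x y : NZ S} {q : List (NZ S)} (h : x.1 * y.1 ≠ 0) :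
    glue (p ++ [x]) (y :: q) = p ++ ⟨x.1 * y.1, h⟩ :: q := by
  rw [glue_concat_cons, dif_neg h]

theorem glue_append_left (p : List (NZ S)) {l : List (NZ S)} (hl : l ≠ []) (m : List (NZ S)) :
    glue (p ++ l) m = p ++ glue l m := by
  induction p with
  | nil => rfl
  | cons a p ih =>
    obtain ⟨b, k, hk⟩ : ∃ b k, p ++ l = b :: k := List.exists_cons_of_ne_nil (by simp [hl])
    rw [List.cons_append, hk, glue, ← hk, ih, List.cons_append]

theorem glue_append_right {l m : List (NZ S)} (hl : l ≠ []) (hm : m ≠ []) (q : List (NZ S)) :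
    glue l (m ++ q) = glue l m ++ q := by
  obtain ⟨p, x, rfl⟩ := List.eq_nil_or_concat' l |>.resolve_left hl
  obtain ⟨y, m, rfl⟩ := List.exists_cons_of_ne_nil hm
  rw [List.cons_append, glue_concat_cons, glue_concat_cons]
  split_ifs <;> simp

theorem glue_ne_nil {l m : List (NZ S)} (hl : l ≠ []) (hm : m ≠ []) : glue l m ≠ [] := by
  obtain ⟨p, x, rfl⟩ := List.eq_nil_or_concat' l |>.resolve_left hl
  obtain ⟨y, m, rfl⟩ := List.exists_cons_of_ne_nil hm
  rw [glue_concat_cons]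
  split_ifs <;> simp

theorem glue_isChain {l m : List (NZ S)} (hl : l ≠ []) (hm : m ≠ [])
    (cl : l.IsChain fun x y => x.1 * y.1 = 0) (cm : m.IsChain fun x y => x.1 * y.1 = 0) :
    (glue l m).IsChain fun x y => x.1 * y.1 = 0 := by
  obtain ⟨p, x, rfl⟩ := List.eq_nil_or_concat' l |>.resolve_left hl
  obtain ⟨y, m, rfl⟩ := List.exists_cons_of_ne_nil hm
  by_cases h : x.1 * y.1 = 0
  · rw [glue_of_eq_zero h, List.isChain_append_cons_cons]
    exact ⟨cl, h, cm⟩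
  · rw [glue_of_ne_zero h, List.isChain_split]
    constructor
    · rw [List.isChain_append] at cl ⊢
      refine ⟨cl.1, List.isChain_singleton _, fun a ha b hb => ?_⟩
      have := cl.2.2 a ha x (by simp)
      simp only [List.head?_cons, Option.mem_some_iff] at hb
      subst hb
      simp only [← mul_assoc, this, zero_mul]
    · rw [List.isChain_cons] at cm ⊢
      refine ⟨fun b hb => ?_, cm.2⟩
      simp only [mul_assoc, cm.1 b hb, mul_zero]

/-- Multiplication of sequences. -/
def Seq.mul (l m : Seq S) : Seq S :=
  ⟨glue l.1 m.1, glue_ne_nil l.2.1 m.2.1, glue_isChain l.2.1 m.2.1 l.2.2 m.2.2⟩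

/-- The class `[x_1, …, x_m]` of a sequence in the gown. -/
def Gown.mk (l : Seq S) : Gown S := Quot.mk _ l

theorem Gown.sound {l m : Seq S} (h : Rho l.1 m.1) : Gown.mk l = Gown.mk m := Quot.sound h

theorem Rho.append_left (p : List (NZ S)) {l m : List (NZ S)} (h : Rho l m) :
    Rho (p ++ l) (p ++ m) := by
  cases h with
  | slide p' q x₁ x₂ y₁ y₂ w h₁ h₂ =>
    simpa using Rho.slide (p ++ p') q x₁ x₂ y₁ y₂ w h₁ h₂
  | split p' q x₀ x₁ x₂ y₀ y₁ w z h h₀ h₁ =>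
    simpa using Rho.split (p ++ p') q x₀ x₁ x₂ y₀ y₁ w z h h₀ h₁

theorem Rho.append_right (q : List (NZ S)) {l m : List (NZ S)} (h : Rho l m) :
    Rho (l ++ q) (m ++ q) := by
  cases h with
  | slide p q' x₁ x₂ y₁ y₂ w h₁ h₂ =>
    simpa using Rho.slide p (q' ++ q) x₁ x₂ y₁ y₂ w h₁ h₂
  | split p q' x₀ x₁ x₂ y₀ y₁ w z h h₀ h₁ =>
    simpa using Rho.split p (q' ++ q) x₀ x₁ x₂ y₀ y₁ w z h h₀ h₁

/-- Multiplication on the left respects the equivalence relation generated by `ρ`. -/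
theorem Gown.mk_mul_congr_right (k l m : Seq S) (h : Rho l.1 m.1) :
    Gown.mk (k.mul l) = Gown.mk (k.mul m) := by
  obtain ⟨k, hk, ck⟩ := k
  obtain ⟨l, hl, cl⟩ := l
  obtain ⟨m, hm, cm⟩ := m
  obtain ⟨r, t, rfl⟩ := List.eq_nil_or_concat' k |>.resolve_left hk
  have cL := glue_isChain hk hl ck cl
  have cM := glue_isChain hk hm ck cm
  dsimp only at h
  cases h with
  | slide p q x₁ x₂ y₁ y₂ w h₁ h₂ =>
    cases p with
    | cons a p =>
      apply Gown.sound
      have e := (Rho.slide p q x₁ x₂ y₁ y₂ w h₁ h₂).append_left (glue (r ++ [t]) [a])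
      rw [← glue_append_right hk (by simp), ← glue_append_right hk (by simp)] at e
      exact e
    | nil =>
      apply Gown.sound
      simp only [Seq.mul, List.nil_append]
      by_cases hx : t.1 * x₁.1 = 0
      · rw [glue_of_eq_zero hx]
        by_cases hy : t.1 * y₁.1 = 0
        · rw [glue_of_eq_zero hy]
          simpa using Rho.slide (r ++ [t]) q x₁ x₂ y₁ y₂ w h₁ h₂
        · rw [glue_of_ne_zero hy]
          exact Rho.split r q t x₁ x₂ _ y₂ y₁.1 w h₁ rfl h₂
      · have hy : t.1 * y₁.1 ≠ 0 := by
          intro h0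
          apply hx
          rw [h₁, ← mul_assoc, h0, zero_mul]
        rw [glue_of_ne_zero hx, glue_of_ne_zero hy]
        exact Rho.slide r q _ x₂ _ y₂ w (by simp [h₁, mul_assoc]) h₂
  | split p q x₀ x₁ x₂ y₀ y₁ w z h h₀ h₁ =>
    cases p with
    | cons a p =>
      apply Gown.sound
      have e := (Rho.split p q x₀ x₁ x₂ y₀ y₁ w z h h₀ h₁).append_left (glue (r ++ [t]) [a])
      rw [← glue_append_right hk (by simp), ← glue_append_right hk (by simp)] at e
      exact e
    | nil =>
      simp only [Seq.mul, List.nil_append] at cL cM ⊢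
      by_cases hx : t.1 * x₀.1 = 0
      · have hy : t.1 * y₀.1 = 0 := by rw [h₀, ← mul_assoc, hx, zero_mul]
        apply Gown.sound
        dsimp only
        rw [glue_of_eq_zero hx, glue_of_eq_zero hy]
        simpa using Rho.split (r ++ [t]) q x₀ x₁ x₂ y₀ y₁ w z h h₀ h₁
      · by_cases hy : t.1 * y₀.1 = 0
        · have hw : w ≠ 0 := by
            rintro rfl
            exact y₀.2 (by rw [h₀, mul_zero])
          have c0 : t.1 * x₀.1 * w = 0 := by rw [mul_assoc, ← h₀, hy]
          have c1 : w * y₁.1 = 0 := by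
            rw [h₁, ← mul_assoc, ← h]
            rw [List.nil_append, List.isChain_cons_cons, List.isChain_cons_cons] at cl
            exact cl.2.1
          have cN : (r ++ ⟨t.1 * x₀.1, hx⟩ :: (⟨w, hw⟩ : NZ S) :: y₁ :: q).IsChain
              fun x y => x.1 * y.1 = 0 := by
            rw [glue_of_ne_zero hx] at cL
            rw [glue_of_eq_zero hy] at cM
            rw [List.isChain_append_cons_cons, List.isChain_cons_cons]
            rw [List.isChain_append_cons_cons, List.isChain_cons_cons] at cM
            rw [List.isChain_split] at cL
            exact ⟨cL.1, c0, c1, cM.2.2.2⟩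
          trans Gown.mk ⟨_, by simp, cN⟩
          · apply Gown.sound
            dsimp only
            rw [glue_of_ne_zero hx]
            have e := Rho.slide (r ++ [⟨t.1 * x₀.1, hx⟩]) q x₁ x₂ ⟨w, hw⟩ y₁ z h h₁
            rw [List.append_assoc, List.append_assoc] at e
            exact e
          · apply Gown.sound
            dsimp only
            rw [glue_of_eq_zero hy]
            exact Rho.slide r (y₁ :: q) _ _ t y₀ x₀.1 rfl h₀
        · apply Gown.sound
          dsimp only
          rw [glue_of_ne_zero hx, glue_of_ne_zero hy]
          exact Rho.split r q _ x₁ x₂ _ y₁ w z h (by simp [h₀, mul_assoc]) h₁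

/-- Multiplication on the right respects the equivalence relation generated by `ρ`. -/
theorem Gown.mk_mul_congr_left (k l m : Seq S) (h : Rho l.1 m.1) :
    Gown.mk (l.mul k) = Gown.mk (m.mul k) := by
  obtain ⟨k, hk, ck⟩ := k
  obtain ⟨l, hl, cl⟩ := l
  obtain ⟨m, hm, cm⟩ := m
  obtain ⟨t, r, rfl⟩ := List.exists_cons_of_ne_nil hk
  have cL := glue_isChain hl hk cl ck
  have cM := glue_isChain hm hk cm ck
  dsimp only at h
  cases h with
  | slide p q x₁ x₂ y₁ y₂ w h₁ h₂ =>
    rcases List.eq_nil_or_concat' q with rfl | ⟨q, a, rfl⟩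
    · have e1 : p ++ [x₁, x₂] = (p ++ [x₁]) ++ [x₂] := by simp
      have e2 : p ++ [y₁, y₂] = (p ++ [y₁]) ++ [y₂] := by simp
      simp only [Seq.mul, e1, e2]
      by_cases hx : x₂.1 * t.1 = 0
      · have hy : y₂.1 * t.1 = 0 := by rw [h₂, mul_assoc, hx, mul_zero]
        apply Gown.sound
        dsimp only
        rw [glue_of_eq_zero hx, glue_of_eq_zero hy]
        simpa using Rho.slide p (t :: r) x₁ x₂ y₁ y₂ w h₁ h₂
      · by_cases hy : y₂.1 * t.1 = 0
        · symm
          apply Gown.sound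
          dsimp only
          rw [glue_of_ne_zero hx, glue_of_eq_zero hy]
          simpa using Rho.split p r y₁ y₂ t x₁ ⟨x₂.1 * t.1, hx⟩ w x₂.1 h₂ h₁ rfl
        · apply Gown.sound
          dsimp only
          rw [glue_of_ne_zero hx, glue_of_ne_zero hy]
          simpa using Rho.slide p r x₁ ⟨x₂.1 * t.1, hx⟩ y₁ ⟨y₂.1 * t.1, hy⟩ w h₁
            (by simp [h₂, mul_assoc])
    · apply Gown.sound
      have e := (Rho.slide p q x₁ x₂ y₁ y₂ w h₁ h₂).append_right (glue [a] (t :: r))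
      rw [← glue_append_left _ (by simp), ← glue_append_left _ (by simp)] at e
      simpa [Seq.mul] using e
  | split p q x₀ x₁ x₂ y₀ y₁ w z h h₀ h₁ =>
    rcases List.eq_nil_or_concat' q with rfl | ⟨q, a, rfl⟩
    · have e1 : p ++ [x₀, x₁, x₂] = (p ++ [x₀, x₁]) ++ [x₂] := by simp
      have e2 : p ++ [y₀, y₁] = (p ++ [y₀]) ++ [y₁] := by simp
      simp only [Seq.mul, e1, e2] at cL cM ⊢
      by_cases hx : x₂.1 * t.1 = 0
      · have hy : y₁.1 * t.1 = 0 := by rw [h₁, mul_assoc, hx, mul_zero]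
        apply Gown.sound
        dsimp only
        rw [glue_of_eq_zero hx, glue_of_eq_zero hy]
        simpa using Rho.split p (t :: r) x₀ x₁ x₂ y₀ y₁ w z h h₀ h₁
      · by_cases hy : y₁.1 * t.1 = 0
        · have hz : z ≠ 0 := by
            rintro rfl
            exact y₁.2 (by rw [h₁, zero_mul])
          have c0 : z * (x₂.1 * t.1) = 0 := by rw [← mul_assoc, ← h₁, hy]
          have c1 : y₀.1 * z = 0 := by
            rw [h₀, mul_assoc, ← h]
            rw [List.isChain_append_cons_cons] at cl
            exact cl.2.1
          have cN : (p ++ y₀ :: (⟨z, hz⟩ : NZ S) :: ⟨x₂.1 * t.1, hx⟩ :: r).IsChain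
              fun x y => x.1 * y.1 = 0 := by
            simp only [glue_of_ne_zero hx] at cL
            rw [List.isChain_append_cons_cons, List.isChain_cons_cons]
            rw [List.isChain_split] at cL
            rw [List.isChain_append_cons_cons] at cm
            exact ⟨cm.1, c1, c0, cL.2⟩
          trans Gown.mk ⟨_, by simp, cN⟩
          · symm
            apply Gown.sound
            dsimp only
            rw [glue_of_ne_zero hx]
            simpa using Rho.slide p (⟨x₂.1 * t.1, hx⟩ :: r) y₀ ⟨z, hz⟩ x₀ x₁ w h₀ h
          · symm
            apply Gown.sound
            dsimp only
            rw [glue_of_eq_zero hy]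
            simpa using Rho.slide (p ++ [y₀]) r y₁ t ⟨z, hz⟩ ⟨x₂.1 * t.1, hx⟩ x₂.1 h₁ rfl
        · apply Gown.sound
          dsimp only
          rw [glue_of_ne_zero hx, glue_of_ne_zero hy]
          simpa using Rho.split p r x₀ x₁ ⟨x₂.1 * t.1, hx⟩ y₀ ⟨y₁.1 * t.1, hy⟩ w z h h₀
            (by simp [h₁, mul_assoc])
    · apply Gown.sound
      have e := (Rho.split p q x₀ x₁ x₂ y₀ y₁ w z h h₀ h₁).append_right (glue [a] (t :: r))
      rw [← glue_append_left _ (by simp), ← glue_append_left _ (by simp)] at e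
      simpa [Seq.mul] using e

theorem Gown.mk_mul_assoc (k l m : Seq S) :
    Gown.mk ((k.mul l).mul m) = Gown.mk (k.mul (l.mul m)) := by
  obtain ⟨k, hk, ck⟩ := k
  obtain ⟨l, hl, cl⟩ := l
  obtain ⟨m, hm, cm⟩ := m
  obtain ⟨p, x, rfl⟩ := List.eq_nil_or_concat' k |>.resolve_left hk
  obtain ⟨z, q, rfl⟩ := List.exists_cons_of_ne_nil hm
  obtain ⟨y, l, rfl⟩ := List.exists_cons_of_ne_nil hl
  rcases List.eq_nil_or_concat' l with rfl | ⟨l, a, rfl⟩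
  · have hzq : z :: q = [z] ++ q := rfl
    have e1 : glue (glue (p ++ [x]) [y]) (z :: q) = p ++ (glue (glue [x] [y]) [z] ++ q) := by
      rw [glue_append_left p (by simp), glue_append_left p (glue_ne_nil (by simp) (by simp)),
        hzq, glue_append_right (glue_ne_nil (by simp) (by simp)) (by simp)]
    have e2 : glue (p ++ [x]) (glue [y] (z :: q)) = p ++ (glue [x] (glue [y] [z]) ++ q) := by
      rw [glue_append_left p (by simp), hzq, glue_append_right (by simp) (by simp),
        glue_append_right (by simp) (glue_ne_nil (by simp) (by simp))]
    by_cases hx : x.1 * y.1 = 0 <;> by_cases hz : y.1 * z.1 = 0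
    · congr 1
      apply Subtype.ext
      simp only [Seq.mul, e1, e2]
      simp [glue, hx, hz]
    · congr 1
      apply Subtype.ext
      simp only [Seq.mul, e1, e2]
      simp [glue, hx, hz, ← mul_assoc]
    · congr 1
      apply Subtype.ext
      simp only [Seq.mul, e1, e2]
      simp [glue, hx, hz, mul_assoc]
    · by_cases hxyz : x.1 * y.1 * z.1 = 0
      · apply Gown.sound
        simp only [Seq.mul, e1, e2]
        have h2 : x.1 * (y.1 * z.1) = 0 := by rw [← mul_assoc, hxyz]
        simp only [glue, hx, hz, hxyz, h2, dif_pos, dif_neg, not_false_eq_true]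
        exact Rho.slide p q _ z x _ y.1 rfl rfl
      · congr 1
        apply Subtype.ext
        simp only [Seq.mul, e1, e2]
        have h2 : x.1 * (y.1 * z.1) ≠ 0 := by rwa [← mul_assoc]
        simp [glue, hx, hz, h2, mul_assoc]
  · congr 1
    apply Subtype.ext
    simp only [Seq.mul]
    rw [← List.cons_append, glue_append_right hk (by simp),
      glue_append_left (glue (p ++ [x]) (y :: l)) (by simp), glue_append_left (y :: l) (by simp),
      glue_append_right hk (by simp)]

/-- The multiplication of sequences makes the gown a semigroup. -/
instance : Semigroup (Gown S) where
  mul := Quot.lift₂ (fun l m => Gown.mk (l.mul m)) Gown.mk_mul_congr_right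
    fun l m k h => Gown.mk_mul_congr_left k l m h
  mul_assoc := by
    rintro ⟨k⟩ ⟨l⟩ ⟨m⟩
    exact Gown.mk_mul_assoc k l m

/-- The element `[x]` of the gown, for `x ∈ S \ 0`. -/
def Gown.of (x : NZ S) : Gown S := Gown.mk ⟨[x], by simp, List.isChain_singleton x⟩

theorem Gown.of_mul_of (x y : NZ S) (h : x.1 * y.1 ≠ 0) :
    Gown.of x * Gown.of y = Gown.of ⟨x.1 * y.1, h⟩ := by
  refine congrArg Gown.mk (Subtype.ext ?_)
  simp [Seq.mul, glue, h]

variable {A : Type v} [AddCommGroup A] [ZeroModule S A]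

/-- `x_1 (⋯ (x_m a) ⋯)`. -/
def seqAct (l : List (NZ S)) (a : A) : A := l.foldr ZeroModule.act a

theorem seqAct_append (l m : List (NZ S)) (a : A) :
    seqAct (l ++ m) a = seqAct l (seqAct m a) := by
  simp [seqAct]

theorem act_act_eq (x y z : NZ S) (h : x.1 = y.1 * z.1) (a : A) :
    ZeroModule.act x a = ZeroModule.act y (ZeroModule.act z a) := by
  obtain ⟨x, hx⟩ := x
  dsimp only at h
  subst h
  exact (ZeroModule.act_act y z hx a).symm

theorem seqAct_rho {l m : List (NZ S)} (h : Rho l m) (a : A) : seqAct l a = seqAct m a := by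
  cases h with
  | slide p q x₁ x₂ y₁ y₂ w h₁ h₂ =>
    have hw : w ≠ 0 := by
      rintro rfl
      exact x₁.2 (by rw [h₁, mul_zero])
    rw [seqAct_append, seqAct_append]
    simp only [seqAct, List.foldr_cons]
    rw [act_act_eq x₁ y₁ ⟨w, hw⟩ h₁, act_act_eq y₂ ⟨w, hw⟩ x₂ h₂]
  | split p q x₀ x₁ x₂ y₀ y₁ w z h h₀ h₁ =>
    have hw : w ≠ 0 := by
      rintro rfl
      exact x₁.2 (by rw [h, zero_mul])
    have hz : z ≠ 0 := by
      rintro rfl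
      exact x₁.2 (by rw [h, mul_zero])
    rw [seqAct_append, seqAct_append]
    simp only [seqAct, List.foldr_cons]
    rw [act_act_eq x₁ ⟨w, hw⟩ ⟨z, hz⟩ h, act_act_eq y₀ x₀ ⟨w, hw⟩ h₀,
      act_act_eq y₁ ⟨z, hz⟩ x₂ h₁]

theorem seqAct_glue {l m : List (NZ S)} (hl : l ≠ []) (hm : m ≠ []) (a : A) :
    seqAct (glue l m) a = seqAct l (seqAct m a) := by
  obtain ⟨p, x, rfl⟩ := List.eq_nil_or_concat' l |>.resolve_left hl
  obtain ⟨y, m, rfl⟩ := List.exists_cons_of_ne_nil hm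
  by_cases h : x.1 * y.1 = 0
  · rw [glue_of_eq_zero h, List.append_cons, seqAct_append]
  · rw [glue_of_ne_zero h, seqAct_append, seqAct_append]
    simp only [seqAct, List.foldr_cons, List.foldr_nil]
    rw [ZeroModule.act_act x y h]

/-- A 0-module over `S` becomes a module over the gown by
`[x_1, …, x_m] a = x_1 (⋯ (x_m a) ⋯)`. -/
instance : SemigroupModule (Gown S) A where
  smul t a := Quot.lift (fun l : Seq S => seqAct l.1 a) (fun _ _ h => seqAct_rho h a) t
  smul_add := by
    rintro ⟨l, hl⟩ a b
    change seqAct l (a + b) = seqAct l a + seqAct l b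
    clear hl
    induction l with
    | nil => rfl
    | cons x l ih =>
      simp only [seqAct, List.foldr_cons] at ih ⊢
      rw [ih, ZeroModule.act_add]
  mul_smul := by
    rintro ⟨l, hl⟩ ⟨m, hm⟩ a
    exact seqAct_glue hl.1 hm.1 a

theorem Gown.of_smul (x : NZ S) (a : A) : Gown.of x • a = ZeroModule.act x a := rfl

end Gown

/-! ### The comparison map -/

section Comparison

variable (S : Type u) (A : Type v) [SemigroupWithZero S] [AddCommGroup A] [ZeroModule S A]

/-- The homomorphism `η^n : C^n(S̃, A) → C_0^n(S, A)`,
`(η^n f) (x_1, …, x_n) = f ([x_1], …, [x_n])` for `x_1 ⋯ x_n ≠ 0`. -/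
def eta (n : ℕ) : Cochain (Gown S) A n →+ ZeroCochain S A n where
  toFun f := fun x => f fun i => Gown.of ⟨x.1 i, x.2.ne_zero i⟩
  map_zero' := rfl
  map_add' _ _ := rfl

theorem eta_coboundary (n : ℕ) (f : Cochain (Gown S) A n) :
    eta S A (n + 1) (coboundary (Gown S) A n f) = zeroCoboundary S A n (eta S A n f) := by
  funext x
  simp only [eta, coboundary, zeroCoboundary, AddMonoidHom.coe_mk, ZeroHom.coe_mk, Gown.of_smul]
  congr 1
  refine Finset.sum_congr rfl fun j _ => ?_
  congr 2
  funext k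
  have hk := (x.2.contract j).ne_zero k
  unfold Fin.contractNth at hk ⊢
  split_ifs with h1 h2
  · rfl
  · rw [if_neg h1, if_pos h2] at hk
    exact Gown.of_mul_of _ _ hk
  · rfl

/-- The homomorphism `ε^n : H^n(S̃, A) → H_0^n(S, A)` induced by `η^n`. -/
def epsilon (n : ℕ) : EMCohomology (Gown S) A n →+ ZeroCohomologyGroup S A n :=
  QuotientAddGroup.map _ _
    (((eta S A n).comp (cocycles (Gown S) A n).subtype).codRestrict (zeroCocycles S A n)
      (by
        rintro ⟨f, hf⟩
        change coboundary (Gown S) A n f = 0 at hf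
        change zeroCoboundary S A n (eta S A n f) = 0
        rw [← eta_coboundary, hf, map_zero]))
    (by
      rintro ⟨f, hf⟩ hb
      cases n with
      | zero =>
        have h0 : f = 0 := hb
        change eta S A 0 f = 0
        rw [h0, map_zero]
      | succ n =>
        obtain ⟨g, hg⟩ : ∃ g, coboundary (Gown S) A n g = f := hb
        exact ⟨eta S A n g, by rw [← eta_coboundary, hg]; rfl⟩)

end Comparison

end

end ZeroCohomology

/-!
The complex of cochains of the gown `T` that vanish on the tuples `([x_1], …, [x_n])` with
`x_1 ⋯ x_n ≠ 0` is the kernel of `η`, and `η` is surjective; so it is enough that this complex is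
acyclic. When `S` is categorical at zero the relation `ρ` is empty: every element of `T` is uniquely
a product of letters `x ∈ S \ 0` with vanishing neighbouring products. Acyclicity then follows from
Brown's collapsing scheme for the bar complex. Read a tuple from the left as long as its entries are
letters with nonzero neighbouring products. If this exhausts the tuple, it is essential; if it stops
at an entry annihilated by the preceding letter, the tuple is collapsible; if it stops at an entry
`y w` that is not a letter, the tuple is redundant, and it is matched with the collapsible tuple in
which `y w` is replaced by `y, w`. A cocycle that vanishes on the essential and the collapsible
tuples is zero, while the values of a coboundary on the collapsible tuples can be prescribed.
-/

namespace ZeroCohomology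

/-! ### The bar differential on functions of lists -/

section Bar

variable {T : Type u} {A : Type v} [AddCommGroup A]

/-- Extension by zero of an `n`-cochain to lists of any length. Cochains of all degrees become
functions of the same type, which allows recursion on the list of arguments. -/
noncomputable def listExtend {n : ℕ} (f : Cochain T A n) : List T → A :=
  Function.extend List.ofFn f 0

theorem listExtend_ofFn {n : ℕ} (f : Cochain T A n) (x : Fin n → T) :
    listExtend f (List.ofFn x) = f x :=
  List.ofFn_injective.extend_apply f 0 x

theorem listExtend_of_length_ne {n : ℕ} (f : Cochain T A n) {l : List T} (h : l.length ≠ n) :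
    listExtend f l = 0 :=
  Function.extend_apply' _ _ _ fun ⟨_, hx⟩ => h (hx ▸ List.length_ofFn)

theorem listExtend_zero {n : ℕ} : listExtend (0 : Cochain T A n) = 0 :=
  Function.extend_zero _

theorem listExtend_injective {n : ℕ} : Function.Injective (listExtend : Cochain T A n → _) :=
  fun f g h => funext fun x => by rw [← listExtend_ofFn f, h, listExtend_ofFn]

theorem exists_ofFn_eq {α : Type*} {n : ℕ} {l : List α} (h : l.length = n) :
    ∃ x : Fin n → α, List.ofFn x = l := by
  subst h
  exact ⟨l.get, List.ofFn_get l⟩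

variable [Semigroup T]

/-- The alternating sum of the values of `f` at the contractions of `x :: l`, in each of which two
neighbours are multiplied or, finally, the last entry is dropped. -/
def contractSum : (List T → A) → T → List T → A
  | f, _, [] => f []
  | f, x, y :: l => f ((x * y) :: l) - contractSum (fun m => f (x :: m)) y l

theorem contractSum_sub (f g : List T → A) (x : T) (l : List T) :
    contractSum (fun m => f m - g m) x l = contractSum f x l - contractSum g x l := by
  induction l generalizing f g x with
  | nil => rfl
  | cons y l ih => simp only [contractSum, ih]; abel

theorem contractSum_mul (f : List T → A) (x y : T) (l : List T) :
    contractSum f (x * y) l = contractSum (contractSum f x) y l := by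
  induction l generalizing f x y with
  | nil => rfl
  | cons z l ih =>
    simp only [contractSum]
    rw [contractSum_sub, ← ih, mul_assoc]
    abel

theorem contractSum_eq_zero_of_length {f : List T → A} {l : List T}
    (hf : ∀ m : List T, m.length = l.length → f m = 0) (x : T) : contractSum f x l = 0 := by
  induction l generalizing f x with
  | nil => exact hf [] rfl
  | cons y l ih =>
    rw [contractSum, hf _ (by simp), ih fun m hm => hf _ (by simp [hm]), sub_zero]

theorem contractSum_ofFn {n : ℕ} (f : List T → A) (x : Fin (n + 1) → T) :
    contractSum f (x 0) (List.ofFn fun i => x i.succ) =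
      ∑ j : Fin (n + 1), (-1 : ℤ) ^ (j : ℕ) • f (List.ofFn (Fin.contractNth j (· * ·) x)) := by
  induction n generalizing f with
  | zero => simp [contractSum]
  | succ n ih =>
    rw [List.ofFn_succ, contractSum, Fin.sum_univ_succ, sub_eq_add_neg]
    rw [ih (fun m => f (x 0 :: m)) fun i => x i.succ, ← Finset.sum_neg_distrib]
    congr 1
    · rw [List.ofFn_succ]
      simp [Fin.contractNth]
    · refine Finset.sum_congr rfl fun j _ => ?_
      have h_head : Fin.contractNth j.succ (· * ·) x 0 = x 0 := by simp [Fin.contractNth]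
      have h_tail : (fun i : Fin n => Fin.contractNth j.succ (· * ·) x i.succ) =
          Fin.contractNth j (· * ·) fun i => x i.succ := by
        funext i
        simp [Fin.contractNth, Fin.castSucc_succ]
      rw [List.ofFn_succ, h_head, h_tail, Fin.val_succ, pow_succ, mul_neg_one, neg_smul]

variable [SemigroupModule T A]

instance SemigroupModule.toDistribSMul : DistribSMul T A where
  smul_zero t := by simpa using SemigroupModule.smul_add t (0 : A) 0
  smul_add := SemigroupModule.smul_add

theorem contractSum_smul (t : T) (f : List T → A) (x : T) (l : List T) :
    contractSum (fun m => t • f m) x l = t • contractSum f x l := by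
  induction l generalizing f x with
  | nil => rfl
  | cons y l ih => simp only [contractSum, ih, smul_sub]

/-- The coboundary operator on functions of lists, acting on all degrees at once. There is no
coboundary in degree `0`, so the value at the empty list is set to `0`. -/
def listCoboundary (f : List T → A) : List T → A
  | [] => 0
  | x :: l => x • f l - contractSum f x l

theorem listCoboundary_sub (f g : List T → A) :
    listCoboundary (f - g) = listCoboundary f - listCoboundary g := by
  funext l
  cases l with
  | nil => simp [listCoboundary]
  | cons x l =>
    have h : contractSum (f - g) x l = contractSum f x l - contractSum g x l :=
      contractSum_sub f g x l
    simp only [listCoboundary, Pi.sub_apply, h, smul_sub]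
    abel

theorem listCoboundary_listCoboundary (f : List T → A) :
    listCoboundary (listCoboundary f) = 0 := by
  funext l
  rcases l with _ | ⟨x, _ | ⟨y, l⟩⟩
  · rfl
  · simp [listCoboundary, contractSum]
  · simp only [listCoboundary, contractSum, Pi.zero_apply]
    rw [contractSum_sub, contractSum_smul, ← contractSum_mul, SemigroupModule.mul_smul, smul_sub]
    abel

theorem listCoboundary_ofFn {n : ℕ} (f : List T → A) (x : Fin (n + 1) → T) :
    listCoboundary f (List.ofFn x) = coboundary T A n (fun y => f (List.ofFn y)) x := by
  rw [List.ofFn_succ]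
  simp only [listCoboundary, coboundary, AddMonoidHom.coe_mk, ZeroHom.coe_mk]
  rw [contractSum_ofFn, sub_eq_add_neg, ← Finset.sum_neg_distrib]
  simp [pow_succ]

theorem listCoboundary_listExtend {n : ℕ} (f : Cochain T A n) :
    listCoboundary (listExtend f) = listExtend (coboundary T A n f) := by
  funext l
  by_cases h : l.length = n + 1
  · obtain ⟨x, rfl⟩ := exists_ofFn_eq h
    simp only [listCoboundary_ofFn, listExtend_ofFn]
  · rw [listExtend_of_length_ne _ h]
    cases l with
    | nil => rfl
    | cons x l =>
      have hl : ∀ m : List T, m.length = l.length → listExtend f m = 0 := fun m hm =>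
        listExtend_of_length_ne f fun hn => h (by rw [List.length_cons, ← hm, hn])
      rw [listCoboundary, hl l rfl, smul_zero, contractSum_eq_zero_of_length hl, sub_zero]

theorem coboundary_coboundary {n : ℕ} (f : Cochain T A n) :
    coboundary T A (n + 1) (coboundary T A n f) = 0 :=
  listExtend_injective <| by
    rw [← listCoboundary_listExtend, ← listCoboundary_listExtend, listCoboundary_listCoboundary,
      listExtend_zero]

end Bar

/-! ### Normal forms in the gown -/

section NormalForm

variable {S : Type u} [SemigroupWithZero S]

theorem CategoricalAtZero.mul_mul_ne_zero (hS : CategoricalAtZero S) {x y z : S}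
    (hxy : x * y ≠ 0) (hyz : y * z ≠ 0) : x * y * z ≠ 0 :=
  fun h => (hS x y z h).elim hxy hyz

theorem CategoricalAtZero.not_rho (hS : CategoricalAtZero S) {l m : List (NZ S)}
    (hl : l.IsChain fun x y => x.1 * y.1 = 0) : ¬ Rho l m := by
  intro h
  cases h with
  | slide p q x₁ x₂ y₁ y₂ w h₁ h₂ =>
    rw [List.isChain_append_cons_cons, h₁] at hl
    exact hS.mul_mul_ne_zero (h₁ ▸ x₁.2) (h₂ ▸ y₂.2) hl.2.1
  | split p q x₀ x₁ x₂ y₀ y₁ w z h h₀ h₁ =>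
    rw [List.isChain_append_cons_cons, h, ← mul_assoc] at hl
    exact hS.mul_mul_ne_zero (h₀ ▸ y₀.2) (h ▸ x₁.2) hl.2.1

namespace Gown

/-- The letters `x_1, …, x_m` of the element `[x_1, …, x_m]` of the gown. They are chosen among all
representatives; when `S` is categorical at zero there is only one. -/
noncomputable def letters (t : Gown S) : List (NZ S) := (Quot.out t).1

theorem letters_ne_nil (t : Gown S) : t.letters ≠ [] := (Quot.out t).2.1

theorem letters_isChain (t : Gown S) : t.letters.IsChain fun x y => x.1 * y.1 = 0 :=
  (Quot.out t).2.2

theorem letters_injective : Function.Injective (letters : Gown S → List (NZ S)) :=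
  fun t u h => by rw [← Quot.out_eq t, ← Quot.out_eq u, Subtype.ext h]

theorem letters_mk (hS : CategoricalAtZero S) (l : Seq S) : (mk l).letters = l.1 :=
  congrArg (Quot.lift Subtype.val fun a _ h => (hS.not_rho a.2.2 h).elim) (Quot.out_eq (mk l))

theorem letters_of (hS : CategoricalAtZero S) (x : NZ S) : (of x).letters = [x] :=
  letters_mk hS _

theorem of_injective (hS : CategoricalAtZero S) : Function.Injective (of : NZ S → Gown S) :=
  fun x y h => by simpa [letters_of hS] using congrArg letters h

theorem letters_mul (hS : CategoricalAtZero S) (t u : Gown S) :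
    (t * u).letters = glue t.letters u.letters := by
  induction t using Quot.ind with | mk l =>
  induction u using Quot.ind with | mk m =>
  exact (letters_mk hS (l.mul m)).trans
    (congrArg₂ glue (letters_mk hS l).symm (letters_mk hS m).symm)

/-- The letter `x` annihilates the first letter of `t`, so that the product `[x] t` is formed by
concatenation. -/
def AnnihilatesHead (x : NZ S) (t : Gown S) : Prop := ∀ y ∈ t.letters.head?, x.1 * y.1 = 0

theorem letters_of_mul (hS : CategoricalAtZero S) {x : NZ S} {t : Gown S}
    (h : AnnihilatesHead x t) : (of x * t).letters = x :: t.letters := by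
  obtain ⟨y, l, hl⟩ := List.exists_cons_of_ne_nil t.letters_ne_nil
  have hxy : x.1 * y.1 = 0 := h y (by simp [hl])
  rw [letters_mul hS, letters_of hS, hl, glue, dif_pos hxy]

theorem annihilatesHead_of (hS : CategoricalAtZero S) {x y : NZ S} :
    AnnihilatesHead x (of y) ↔ x.1 * y.1 = 0 := by
  simp [AnnihilatesHead, letters_of hS]

theorem annihilatesHead_of_mul (hS : CategoricalAtZero S) {x y : NZ S} {t : Gown S}
    (h : AnnihilatesHead y t) : AnnihilatesHead x (of y * t) ↔ x.1 * y.1 = 0 := by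
  simp [AnnihilatesHead, letters_of_mul hS h]

theorem AnnihilatesHead.of_mul_left {x y : NZ S} (h : x.1 * y.1 ≠ 0) {t : Gown S}
    (ht : AnnihilatesHead y t) : AnnihilatesHead ⟨x.1 * y.1, h⟩ t :=
  fun z hz => by rw [mul_assoc, ht z hz, mul_zero]

theorem AnnihilatesHead.mul_right (hS : CategoricalAtZero S) {x : NZ S} {t : Gown S}
    (h : AnnihilatesHead x t) (u : Gown S) : AnnihilatesHead x (t * u) := by
  obtain ⟨y, l, hl⟩ := List.exists_cons_of_ne_nil t.letters_ne_nil
  obtain ⟨z, m, hm⟩ := List.exists_cons_of_ne_nil u.letters_ne_nil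
  have hxy : x.1 * y.1 = 0 := h y (by simp [hl])
  rw [AnnihilatesHead, letters_mul hS, hl, hm]
  cases l with
  | nil =>
    by_cases hyz : y.1 * z.1 = 0
    · simpa [glue, hyz] using hxy
    · simp [glue, hyz, ← mul_assoc, hxy]
  | cons y' l => simpa [glue] using hxy

/-- The product `[x] [x_1] ⋯ [x_m]` of a letter and a list of letters. -/
noncomputable def word : NZ S → List (NZ S) → Gown S
  | x, [] => of x
  | x, y :: l => of x * word y l

theorem letters_word (hS : CategoricalAtZero S) {x : NZ S} {l : List (NZ S)}
    (h : (x :: l).IsChain fun x y => x.1 * y.1 = 0) : (word x l).letters = x :: l := by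
  induction l generalizing x with
  | nil => exact letters_of hS x
  | cons y l ih =>
    have hl := ih h.tail
    have hx : AnnihilatesHead x (word y l) := by
      simpa [AnnihilatesHead, hl] using h.rel
    rw [word, letters_of_mul hS hx, hl]

theorem word_eq (hS : CategoricalAtZero S) {t : Gown S} {x : NZ S} {l : List (NZ S)}
    (h : t.letters = x :: l) : word x l = t :=
  letters_injective ((letters_word hS (h ▸ t.letters_isChain)).trans h.symm)

theorem induction (hS : CategoricalAtZero S) {P : Gown S → Prop} (of : ∀ x, P (of x))
    (of_mul : ∀ x t, AnnihilatesHead x t → P t → P (Gown.of x * t)) (t : Gown S) : P t := by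
  obtain ⟨x, l, h⟩ := List.exists_cons_of_ne_nil t.letters_ne_nil
  have hl := h ▸ t.letters_isChain
  rw [← word_eq hS h]
  clear h t
  induction l generalizing x with
  | nil => exact of x
  | cons y l ih =>
    refine of_mul x (word y l) ?_ (ih y hl.tail)
    simpa [AnnihilatesHead, letters_word hS hl.tail] using hl.rel

end Gown

end NormalForm

/-! ### Collapsing the bar complex of the gown -/

section Collapsing

open Gown

variable {S : Type u} [SemigroupWithZero S]

/-- The list `[x] :: l` is essential or collapsible: its entries are letters with nonzero
neighbouring products, either throughout or up to an entry annihilated by the preceding letter. -/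
inductive IrredundantAfter : NZ S → List (Gown S) → Prop
  | nil (x : NZ S) : IrredundantAfter x []
  | annihilated {x : NZ S} {t : Gown S} (h : AnnihilatesHead x t) (l : List (Gown S)) :
      IrredundantAfter x (t :: l)
  | cons {x y : NZ S} (h : x.1 * y.1 ≠ 0) {l : List (Gown S)} (hl : IrredundantAfter y l) :
      IrredundantAfter x (of y :: l)

theorem IrredundantAfter.of_mul_left (hS : CategoricalAtZero S) {x y : NZ S} (h : x.1 * y.1 ≠ 0)
    {l : List (Gown S)} (hl : IrredundantAfter y l) : IrredundantAfter ⟨x.1 * y.1, h⟩ l := by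
  cases hl with
  | nil => exact .nil _
  | annihilated ht l => exact .annihilated (ht.of_mul_left h) l
  | cons hz hl => exact .cons (hS.mul_mul_ne_zero h hz) hl

theorem IrredundantAfter.of_isChain {x : NZ S} {m : List (NZ S)}
    (h : (x :: m).IsChain fun x y => x.1 * y.1 ≠ 0) : IrredundantAfter x (m.map of) := by
  induction m generalizing x with
  | nil => exact .nil x
  | cons y m ih => exact .cons h.rel (ih h.tail)

variable {A : Type v} [AddCommGroup A]

theorem contractSum_eq_zero_of_annihilatesHead (hS : CategoricalAtZero S) {g : List (Gown S) → A}
    {x : NZ S} (hg : ∀ l, IrredundantAfter x l → g l = 0) {t : Gown S} (ht : AnnihilatesHead x t)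
    (l : List (Gown S)) : contractSum g t l = 0 := by
  cases l with
  | nil => exact hg [] (.nil x)
  | cons u l =>
    rw [contractSum, hg _ (.annihilated (ht.mul_right hS u) l),
      contractSum_eq_zero_of_length fun m _ => hg _ (.annihilated ht m), sub_zero]

theorem eq_zero_of_contractSum_eq_zero (hS : CategoricalAtZero S) {g : List (Gown S) → A}
    {x : NZ S} (hg : ∀ l, IrredundantAfter x l → g l = 0)
    (h : ∀ (y : NZ S) (l : List (Gown S)), x.1 * y.1 ≠ 0 → IrredundantAfter y l →
      contractSum g (of y) l = 0) (l : List (Gown S)) : g l = 0 := by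
  induction l generalizing g x with
  | nil => exact hg [] (.nil x)
  | cons t l ih =>
    by_cases hx : AnnihilatesHead x t
    · exact hg _ (.annihilated hx l)
    induction t using Gown.induction hS with
    | of y =>
      replace hx : x.1 * y.1 ≠ 0 := mt (annihilatesHead_of hS).2 hx
      refine ih (g := fun m => g (of y :: m)) (fun m hm => hg _ (.cons hx hm)) fun z m hz hm => ?_
      have hxyz : x.1 * (y.1 * z.1) ≠ 0 := mul_assoc x.1 y.1 z.1 ▸ hS.mul_mul_ne_zero hx hz
      simpa [contractSum, of_mul_of y z hz, hg _ (.cons hxyz (hm.of_mul_left hS hz))]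
        using h y (of z :: m) hx (.cons hz hm)
    | of_mul y w hw _ =>
      replace hx : x.1 * y.1 ≠ 0 := mt (annihilatesHead_of_mul hS hw).2 hx
      have hyw : contractSum (fun m => g (of y :: m)) w l = 0 :=
        contractSum_eq_zero_of_annihilatesHead hS (fun m hm => hg _ (.cons hx hm)) hw l
      simpa [contractSum, hyw] using h y (w :: l) hx (.annihilated hw l)

open Classical in
/-- If `[x] :: l` is redundant, this is up to sign the value of `φ` at the list obtained from `l` by
splitting the first letter off its first entry that is not a letter; otherwise it is `0`. It inverts
`contractSum` on the functions that vanish after `x` on irredundant lists. -/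
noncomputable def splitEval : NZ S → (List (Gown S) → A) → List (Gown S) → A
  | _, _, [] => 0
  | x, φ, t :: l =>
    if AnnihilatesHead x t then 0
    else match t.letters with
      | [] => 0
      | [y] => splitEval y (fun m => -φ (of y :: m)) l
      | y :: z :: k => φ (of y :: word z k :: l)

theorem splitEval_of_annihilatesHead {x : NZ S} {t : Gown S} (h : AnnihilatesHead x t)
    (φ : List (Gown S) → A) (l : List (Gown S)) : splitEval x φ (t :: l) = 0 := by
  rw [splitEval, if_pos h]

theorem splitEval_of (hS : CategoricalAtZero S) {x y : NZ S} (h : x.1 * y.1 ≠ 0)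
    (φ : List (Gown S) → A) (l : List (Gown S)) :
    splitEval x φ (of y :: l) = splitEval y (fun m => -φ (of y :: m)) l := by
  rw [splitEval, if_neg (mt (annihilatesHead_of hS).1 h), letters_of hS]

theorem splitEval_of_mul (hS : CategoricalAtZero S) {x y : NZ S} (h : x.1 * y.1 ≠ 0) {w : Gown S}
    (hw : AnnihilatesHead y w) (φ : List (Gown S) → A) (l : List (Gown S)) :
    splitEval x φ (of y * w :: l) = φ (of y :: w :: l) := by
  obtain ⟨z, k, hk⟩ := List.exists_cons_of_ne_nil w.letters_ne_nil
  rw [splitEval, if_neg (mt (annihilatesHead_of_mul hS hw).1 h), letters_of_mul hS hw, hk,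
    ← word_eq hS hk]

theorem splitEval_of_irredundantAfter (hS : CategoricalAtZero S) {x : NZ S}
    (φ : List (Gown S) → A) {l : List (Gown S)} (hl : IrredundantAfter x l) :
    splitEval x φ l = 0 := by
  induction hl generalizing φ with
  | nil => rfl
  | annihilated ht l => exact splitEval_of_annihilatesHead ht φ l
  | cons hy _ ih => rw [splitEval_of hS hy, ih]

theorem contractSum_splitEval (hS : CategoricalAtZero S) {x y : NZ S} (hxy : x.1 * y.1 ≠ 0)
    {φ : List (Gown S) → A}
    (hφ : ∀ m : List (NZ S), ((y :: m).IsChain fun x y => x.1 * y.1 ≠ 0) →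
      φ (of y :: m.map of) = 0)
    {l : List (Gown S)} (hl : IrredundantAfter y l) :
    contractSum (splitEval x φ) (of y) l = φ (of y :: l) := by
  induction hl generalizing x φ with
  | nil y => exact (hφ [] (.singleton y)).symm
  | annihilated ht l =>
    simp only [contractSum, splitEval_of_mul hS hxy ht, splitEval_of hS hxy]
    rw [contractSum_eq_zero_of_annihilatesHead hS
      (fun m hm => splitEval_of_irredundantAfter hS _ hm) ht, sub_zero]
  | @cons y z hyz l hl ih =>
    have hxyz : x.1 * (y.1 * z.1) ≠ 0 := mul_assoc x.1 y.1 z.1 ▸ hS.mul_mul_ne_zero hxy hyz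
    simp only [contractSum, of_mul_of y z hyz, splitEval_of hS hxy]
    rw [splitEval_of_irredundantAfter hS φ (.cons hxyz (hl.of_mul_left hS hyz)), ih hyz, zero_sub,
      neg_neg]
    exact fun m hm => neg_eq_zero.2 (hφ (z :: m) (.cons_cons hyz hm))

variable [ZeroModule S A]

theorem eq_zero_of_listCoboundary_eq_zero (hS : CategoricalAtZero S) {f : List (Gown S) → A}
    (hd : listCoboundary f = 0) (h_nil : f [] = 0)
    (hf : ∀ x l, IrredundantAfter x l → f (of x :: l) = 0) : f = 0 := by
  funext l
  cases l with
  | nil => exact h_nil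
  | cons t l =>
    induction t using Gown.induction hS with
    | of x =>
      refine eq_zero_of_contractSum_eq_zero hS (g := fun m => f (of x :: m)) (hf x)
        (fun y m hy hm => ?_) l
      simpa [listCoboundary, contractSum, of_mul_of x y hy, hf y m hm,
        hf _ m (hm.of_mul_left hS hy)] using congrFun hd (of x :: of y :: m)
    | of_mul x w hw ih =>
      have hxw : contractSum (fun m => f (of x :: m)) w l = 0 :=
        contractSum_eq_zero_of_annihilatesHead hS (hf x) hw l
      simpa [listCoboundary, contractSum, ih, hxw] using congrFun hd (of x :: w :: l)

/-- The value of `primitive f` at `t :: l`, by recursion on the letters of `t`. -/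
noncomputable def primitiveCons (f : List (Gown S) → A) : List (NZ S) → List (Gown S) → A
  | [], _ => 0
  | [x], l => splitEval x (fun m => f (of x :: m)) l
  | x :: y :: k, l => of x • primitiveCons f (y :: k) l - f (of x :: word y k :: l)

/-- The function that vanishes on the essential and the collapsible lists and whose coboundary
agrees with `f` on the collapsible ones. -/
noncomputable def primitive (f : List (Gown S) → A) : List (Gown S) → A
  | [] => 0
  | t :: l => primitiveCons f t.letters l

theorem primitive_of (hS : CategoricalAtZero S) (f : List (Gown S) → A) (x : NZ S)
    (l : List (Gown S)) :
    primitive f (of x :: l) = splitEval x (fun m => f (of x :: m)) l := by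
  rw [primitive, letters_of hS, primitiveCons]

theorem primitive_of_mul (hS : CategoricalAtZero S) (f : List (Gown S) → A) {x : NZ S}
    {w : Gown S} (hw : AnnihilatesHead x w) (l : List (Gown S)) :
    primitive f (of x * w :: l) = of x • primitive f (w :: l) - f (of x :: w :: l) := by
  obtain ⟨y, k, hk⟩ := List.exists_cons_of_ne_nil w.letters_ne_nil
  rw [primitive, primitive, letters_of_mul hS hw, hk, primitiveCons, word_eq hS hk]

theorem primitive_of_irredundantAfter (hS : CategoricalAtZero S) (f : List (Gown S) → A)
    {x : NZ S} {l : List (Gown S)} (hl : IrredundantAfter x l) : primitive f (of x :: l) = 0 := by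
  rw [primitive_of hS, splitEval_of_irredundantAfter hS _ hl]

theorem primitive_map_of (hS : CategoricalAtZero S) (f : List (Gown S) → A) {m : List (NZ S)}
    (hm : m.IsChain fun x y => x.1 * y.1 ≠ 0) : primitive f (m.map of) = 0 := by
  cases m with
  | nil => rfl
  | cons x m => exact primitive_of_irredundantAfter hS f (.of_isChain hm)

theorem listCoboundary_primitive_of_irredundantAfter (hS : CategoricalAtZero S)
    {f : List (Gown S) → A}
    (hf : ∀ m : List (NZ S), (m.IsChain fun x y => x.1 * y.1 ≠ 0) → f (m.map of) = 0)
    {x : NZ S} {l : List (Gown S)} (hl : IrredundantAfter x l) :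
    listCoboundary (primitive f) (of x :: l) = f (of x :: l) := by
  cases hl with
  | nil => simpa [listCoboundary, contractSum, primitive] using (hf [x] (.singleton x)).symm
  | @annihilated _ t ht l =>
    have hxt : contractSum (fun m => primitive f (of x :: m)) t l = 0 :=
      contractSum_eq_zero_of_annihilatesHead hS
        (fun m hm => primitive_of_irredundantAfter hS f hm) ht l
    simp [listCoboundary, contractSum, primitive_of_mul hS f ht, hxt]
  | @cons _ y hxy l hl =>
    have h_inner : contractSum (fun m => primitive f (of x :: m)) (of y) l =
        f (of x :: of y :: l) := by
      simp only [primitive_of hS]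
      exact contractSum_splitEval hS hxy (fun m hm => hf (x :: y :: m) (.cons_cons hxy hm)) hl
    simp [listCoboundary, contractSum, of_mul_of x y hxy, h_inner,
      primitive_of_irredundantAfter hS f hl,
      primitive_of_irredundantAfter hS f (hl.of_mul_left hS hxy)]

theorem listCoboundary_primitive (hS : CategoricalAtZero S) {f : List (Gown S) → A}
    (hd : listCoboundary f = 0)
    (hf : ∀ m : List (NZ S), (m.IsChain fun x y => x.1 * y.1 ≠ 0) → f (m.map of) = 0) :
    listCoboundary (primitive f) = f := by
  refine (sub_eq_zero.1 (eq_zero_of_listCoboundary_eq_zero hS ?_ ?_ fun x l hl => ?_)).symm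
  · rw [listCoboundary_sub, hd, listCoboundary_listCoboundary, sub_zero]
  · simpa [listCoboundary] using hf [] .nil
  · rw [Pi.sub_apply, listCoboundary_primitive_of_irredundantAfter hS hf hl, sub_self]

end Collapsing

/-! ### The kernel of the comparison map -/

section Kernel

variable {S : Type u} [SemigroupWithZero S]

theorem isChain_of_prod_ne_zero {m : List (NZ S)}
    (h : (m.map fun x => (x.1 : WithOne S)).prod ≠ ((0 : S) : WithOne S)) :
    m.IsChain fun x y => x.1 * y.1 ≠ 0 := by
  induction m with
  | nil => exact .nil
  | cons x m ih =>
    rw [List.map_cons, List.prod_cons] at h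
    refine List.isChain_cons.2 ⟨fun y hy hxy => h ?_, ih fun h0 => h (by rw [h0, mul_coe_zero])⟩
    obtain ⟨m, rfl⟩ := List.head?_eq_some_iff.1 hy
    rw [List.map_cons, List.prod_cons, ← mul_assoc, ← WithOne.coe_mul, hxy, coe_zero_mul]

theorem CategoricalAtZero.coe_mul_mul_ne_zero (hS : CategoricalAtZero S) {x y : S} {w : WithOne S}
    (hxy : x * y ≠ 0) (hyw : (y : WithOne S) * w ≠ ((0 : S) : WithOne S)) :
    (x : WithOne S) * (y * w) ≠ ((0 : S) : WithOne S) := by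
  cases w with
  | one => rwa [mul_one, ← WithOne.coe_mul, Ne, WithOne.coe_inj]
  | coe a =>
    rw [← WithOne.coe_mul, Ne, WithOne.coe_inj] at hyw
    rw [← mul_assoc, ← WithOne.coe_mul, ← WithOne.coe_mul, Ne, WithOne.coe_inj]
    exact hS.mul_mul_ne_zero hxy hyw

theorem CategoricalAtZero.prod_ne_zero (hS : CategoricalAtZero S) {m : List (NZ S)}
    (h : m.IsChain fun x y => x.1 * y.1 ≠ 0) :
    (m.map fun x => (x.1 : WithOne S)).prod ≠ ((0 : S) : WithOne S) := by
  induction h with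
  | nil => simp
  | singleton x => simpa using x.2
  | cons_cons hxy _ ih => exact hS.coe_mul_mul_ne_zero hxy ih

theorem NonzeroProd.isChain {n : ℕ} {x : Fin n → S} (h : NonzeroProd x) :
    (List.ofFn fun i => (⟨x i, h.ne_zero i⟩ : NZ S)).IsChain fun x y => x.1 * y.1 ≠ 0 :=
  isChain_of_prod_ne_zero (by rw [List.map_ofFn]; exact h)

theorem CategoricalAtZero.nonzeroProd (hS : CategoricalAtZero S) {n : ℕ} {x : Fin n → NZ S}
    (h : (List.ofFn x).IsChain fun x y => x.1 * y.1 ≠ 0) : NonzeroProd fun i => (x i).1 := by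
  have h_prod := hS.prod_ne_zero h
  rwa [List.map_ofFn] at h_prod

variable {A : Type v} [AddCommGroup A]

theorem eta_surjective (hS : CategoricalAtZero S) (n : ℕ) : Function.Surjective (eta S A n) := by
  intro f
  have h_inj : Function.Injective fun (x : {x : Fin n → S // NonzeroProd x}) i =>
      Gown.of (⟨x.1 i, x.2.ne_zero i⟩ : NZ S) := fun x y h =>
    Subtype.ext (funext fun i => congrArg Subtype.val (Gown.of_injective hS (congrFun h i)))
  exact ⟨Function.extend _ f 0, funext (h_inj.extend_apply f 0)⟩

theorem eta_zero_injective : Function.Injective (eta S A 0) := by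
  intro f g h
  funext x
  rw [Subsingleton.elim x]
  exact congrFun h ⟨Fin.elim0, by simp [NonzeroProd, tupleProd]⟩

theorem listExtend_map_of_eq_zero (hS : CategoricalAtZero S) {n : ℕ} {f : Cochain (Gown S) A n}
    (hf : eta S A n f = 0) {m : List (NZ S)} (hm : m.IsChain fun x y => x.1 * y.1 ≠ 0) :
    listExtend f (m.map Gown.of) = 0 := by
  by_cases h : m.length = n
  · obtain ⟨x, rfl⟩ := exists_ofFn_eq h
    rw [List.map_ofFn, listExtend_ofFn]
    exact congrFun hf ⟨_, hS.nonzeroProd hm⟩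
  · exact listExtend_of_length_ne f (by rwa [List.length_map])

variable [ZeroModule S A]

theorem exists_coboundary_eq_of_eta_eq_zero (hS : CategoricalAtZero S) {n : ℕ}
    {f : Cochain (Gown S) A (n + 1)} (hd : coboundary (Gown S) A (n + 1) f = 0)
    (hf : eta S A (n + 1) f = 0) :
    ∃ g : Cochain (Gown S) A n, eta S A n g = 0 ∧ coboundary (Gown S) A n g = f := by
  refine ⟨fun x => primitive (listExtend f) (List.ofFn x), ?_, ?_⟩
  · funext x
    have h := primitive_map_of hS (listExtend f) x.2.isChain
    rwa [List.map_ofFn] at h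
  · have hd' : listCoboundary (listExtend f) = 0 := by
      rw [listCoboundary_listExtend, hd, listExtend_zero]
    funext x
    rw [← listCoboundary_ofFn,
      listCoboundary_primitive hS hd' fun m hm => listExtend_map_of_eq_zero hS hf hm,
      listExtend_ofFn]

theorem exists_cocycle_eta_eq (hS : CategoricalAtZero S) {n : ℕ} {f : ZeroCochain S A n}
    (hf : f ∈ zeroCocycles S A n) : ∃ g ∈ cocycles (Gown S) A n, eta S A n g = f := by
  obtain ⟨g, rfl⟩ := eta_surjective hS n f
  obtain ⟨h, h_eta, h_cob⟩ := exists_coboundary_eq_of_eta_eq_zero hS (coboundary_coboundary g)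
    ((eta_coboundary S A n g).trans hf)
  refine ⟨g - h, ?_, by rw [map_sub, h_eta, sub_zero]⟩
  rw [cocycles, AddMonoidHom.mem_ker, map_sub, h_cob, sub_self]

theorem mem_coboundaries_of_eta_mem (hS : CategoricalAtZero S) {n : ℕ} {f : Cochain (Gown S) A n}
    (hd : f ∈ cocycles (Gown S) A n) (hf : eta S A n f ∈ zeroCoboundaries S A n) :
    f ∈ coboundaries (Gown S) A n := by
  cases n with
  | zero =>
    have h_eta : eta S A 0 f = 0 := hf
    exact eta_zero_injective (h_eta.trans (map_zero _).symm)
  | succ n =>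
    obtain ⟨g₀, hg⟩ : ∃ g₀, zeroCoboundary S A n g₀ = eta S A (n + 1) f := hf
    obtain ⟨g, rfl⟩ := eta_surjective hS n g₀
    have h_cocycle : coboundary (Gown S) A (n + 1) (f - coboundary (Gown S) A n g) = 0 := by
      rw [map_sub, AddMonoidHom.mem_ker.1 hd, coboundary_coboundary, sub_zero]
    have h_eta : eta S A (n + 1) (f - coboundary (Gown S) A n g) = 0 := by
      rw [map_sub, eta_coboundary, hg, sub_self]
    obtain ⟨h, -, hh⟩ := exists_coboundary_eq_of_eta_eq_zero hS h_cocycle h_eta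
    exact ⟨h + g, by rw [map_add, hh, sub_add_cancel]⟩

end Kernel

end ZeroCohomology

theorem theorem5 {S : Type*} {A : Type*} [SemigroupWithZero S] [AddCommGroup A]
    [ZeroCohomology.ZeroModule S A] (hS : ZeroCohomology.CategoricalAtZero S) (n : ℕ) :
    Function.Bijective (ZeroCohomology.epsilon S A n) := by
  constructor
  · rw [injective_iff_map_eq_zero]
    intro c hc
    induction c using QuotientAddGroup.induction_on with
    | H f =>
      have h_eta := (QuotientAddGroup.eq_zero_iff _).1 hc
      exact (QuotientAddGroup.eq_zero_iff f).2
        (ZeroCohomology.mem_coboundaries_of_eta_mem hS f.2 h_eta)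
  · intro c
    induction c using QuotientAddGroup.induction_on with
    | H f =>
      obtain ⟨g, hg, hgf⟩ := ZeroCohomology.exists_cocycle_eta_eq hS f.2
      exact ⟨QuotientAddGroup.mk ⟨g, hg⟩, congrArg QuotientAddGroup.mk (Subtype.ext hgf)⟩
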